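/- Let $\mathbb F=\mathbb Z/2\mathbb Z$. Let $G$ be a plumbing tree, that is, a finite tree with vertex set $V$ whose vertices $v$ carry integer framings $m_v$. Let $X_G$ be the plumbing of disk bundles over spheres defined by $G$ and $Y_G=\partial X_G$. Then $H_2(X_G;\mathbb Z)=\mathbb Z^V$, and its intersection form is given by $v\cdot v=m_v$, $v\cdot w=1$ if $vw$ is an edge and $v\cdot w=0$ for other pairs $v\neq w$. Assume that $G$ is negative definite, i.e. $x\cdot x<0$ for all $x\ne 0$. Let $Char(G)$ be the set of $K\in \mathrm{Hom}(H_2(X_G;\mathbb Z),\mathbb Z)=H^2(X_G;\mathbb Z)$ with $K(x)\equiv x\cdot x \pmod 2$ for all $x$, and for $v\in V$ put $v^*=(v\,\cdot\,-)\in H^2(X_G;\mathbb Z)$. A spin$^c$ structure $\mathfrak s$ on $Y_G$ is identified with an equivalence class of elements of $Char(G)$, where $K\sim K'$ if and only if $K-K'\in 2H^2(X_G,Y_G;\mathbb Z)$, i.e. $K-K'=2(x\,\cdot\,-)$ for some $x\in H_2(X_G;\mathbb Z)$; the class of $K$ is denoted $\mathfrak s_K$. For $K\in Char(G)$ and finite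 sets $I,E\subseteq V$ let $$f([K,I])=\tfrac12\Big(\sum_{v\in I}K(v)+\Big(\sum_{v\in I}v\Big)\cdot\Big(\sum_{v\in I}v\Big)\Big)\in\mathbb Z,\qquad g([K,E])=\min\{f([K,I]) \mid I\subseteq E\},$$ and for $v\in E$ let $$a_v[K,E]=g([K,E-v])-g([K,E]),\qquad b_v[K,E]=\min\{f([K,I])\mid v\in I\subseteq E\}-g([K,E]),$$ which are nonnegative integers. Let $CF^-(G,\mathfrak s)$ be the free $\mathbb F[U]$-module on the pairs $[K,E]$ with $K\in Char(G)$, $\mathfrak s_K=\mathfrak s$ and $E\subseteq V$, graded by the $\delta$-degree $|E|$ of $[K,E]$ (with $U$ of $\delta$-degree $0$), with the boundary map $$\partial[K,E]=\sum_{v\in E}\Big(U^{a_v[K,E]}[K,E-v]+U^{b_v[K,E]}[K+2v^*,E-v]\Big),$$ which satisfies $\partial^2=0$. Let $HF^-(G,\mathfrak s)=\ker\partial/\operatorname{im}\partial$, and let $HF^-_k(G,\mathfrak s)$ be its submodule of classes of cycles of $\delta$-degree $k$. Theorem (Némethi). For every negative definite plumbing tree $G$ and every spin$^c$ structure $\mathfrak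 s$ on $Y_G$, the lattice homology $HF^-(G,\mathfrak s)$ is a finitely generated $\mathbb F[U]$-module. There are finitely many integers $n_1,\dots,n_r\geq 1$ (possibly $r=0$) and an isomorphism of $\mathbb F[U]$-modules $$HF^-(G,\mathfrak s)\cong \mathbb F[U]\oplus\bigoplus_{i=1}^r\mathbb F[U]/(U^{n_i})$$ under which the free summand $\mathbb F[U]$ corresponds to a submodule of $HF^-_0(G,\mathfrak s)$. -/

import Mathlib

open Polynomial
open scoped DirectSum

namespace SqZero

variable {R M : Type*} [Ring R] [AddCommGroup M] [Module R M] (d : M →ₗ[R] M) (h : d ∘ₗ d = 0)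

/-- The homology `ker d / im d` of a module with an endomorphism `d` such that `d² = 0`. -/
abbrev Homology : Type _ :=
  LinearMap.ker d ⧸
    LinearMap.range (d.codRestrict (LinearMap.ker d) fun c => LinearMap.congr_fun h c)

/-- The submodule of the homology that consists of the classes of the cycles lying in `S`. -/
def classesOf (S : Submodule R M) : Submodule R (Homology d h) :=
  (S.comap (LinearMap.ker d).subtype).map (Submodule.mkQ _)

end SqZero

/-- A plumbing graph: a graph whose vertices carry integer framings. -/
structure PlumbingGraph (V : Type*) where
  graph : SimpleGraph V
  framing : V → ℤ

namespace PlumbingGraph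

noncomputable section

variable {V : Type*} [Fintype V] [DecidableEq V] (G : PlumbingGraph V)

open Classical in
/-- The incidence matrix `M_G`, with the framings on the diagonal. -/
def incidence : Matrix V V ℤ :=
  Matrix.of fun v w =>
    if v = w then G.framing v else if G.graph.Adj v w then 1 else 0

/-- The intersection form on `H₂(X_G; ℤ) = ℤ^V`, given by `M_G` in the basis of vertices. -/
def form : LinearMap.BilinForm ℤ (V → ℤ) := Matrix.toBilin' G.incidence

/-- `G` is negative definite: so is its intersection form. -/
def NegDef : Prop := ∀ x : V → ℤ, x ≠ 0 → G.form x x < 0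

/-- The class in `H₂(X_G; ℤ)` of the sphere corresponding to the vertex `v`. -/
def vert (v : V) : V → ℤ := Pi.single v 1

/-- The characteristic elements of `H²(X_G; ℤ) = Hom(H₂(X_G; ℤ), ℤ)`. -/
def Char : Type _ :=
  {K : Module.Dual ℤ (V → ℤ) // ∀ x, K x ≡ G.form x x [ZMOD 2]}

/-- `K ∼ K'` iff `K - K' ∈ 2 H²(X_G, Y_G; ℤ)`. Here `H²(X_G, Y_G; ℤ)` is identified with
`H₂(X_G; ℤ)` by Poincaré duality, and its map to `H²(X_G; ℤ)` is `x ↦ (x · -)`. -/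
def spincSetoid : Setoid G.Char where
  r K K' := ∃ x : V → ℤ, K.1 - K'.1 = (2 : ℤ) • G.form x
  iseqv :=
    { refl := fun K => ⟨0, by simp⟩
      symm := by
        rintro K K' ⟨x, hx⟩
        exact ⟨-x, by rw [map_neg, smul_neg, ← hx, neg_sub]⟩
      trans := by
        rintro K K' K'' ⟨x, hx⟩ ⟨y, hy⟩
        exact ⟨x + y, by rw [map_add, smul_add, ← hx, ← hy, sub_add_sub_cancel]⟩ }

/-- The spin^c structures on `Y_G`: every one of them is `𝔰_K` for some characteristic `K`,
and `𝔰_K = 𝔰_K'` iff `K - K' ∈ 2 H²(X_G, Y_G; ℤ)`. -/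
def SpinC : Type _ := Quotient G.spincSetoid

variable {G}

/-- The spin^c structure `𝔰_K` on `Y_G` induced by `K`. -/
def Char.spinc (K : G.Char) : G.SpinC := Quotient.mk G.spincSetoid K

/-- The characteristic element `K + 2 v^*`, where `v^* = (v · -)`. -/
def Char.shift (K : G.Char) (v : V) : G.Char :=
  ⟨K.1 + (2 : ℤ) • G.form (vert v), fun x => by
    have h := K.2 x
    simp only [LinearMap.add_apply, LinearMap.smul_apply, smul_eq_mul]
    exact (Int.modEq_iff_dvd.2 ⟨-(G.form (vert v) x), by ring⟩ :
      K.1 x + 2 * G.form (vert v) x ≡ K.1 x [ZMOD 2]).trans h⟩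

theorem Char.spinc_shift (K : G.Char) (v : V) : (K.shift v).spinc = K.spinc :=
  Quotient.sound (s := G.spincSetoid) ⟨vert v, by simp [Char.shift]⟩

/-- The `G`-weight `f([K, I])`, where `2 f([K, I]) = ∑_{v ∈ I} K(v) + (∑_{v ∈ I} v)²`
(an even integer, see `two_mul_weight`). -/
def weight (K : G.Char) (I : Finset V) : ℤ :=
  (∑ v ∈ I, K.1 (vert v) + G.form (∑ v ∈ I, vert v) (∑ v ∈ I, vert v)) / 2

theorem two_mul_weight (K : G.Char) (I : Finset V) :
    2 * weight K I =
      ∑ v ∈ I, K.1 (vert v) + G.form (∑ v ∈ I, vert v) (∑ v ∈ I, vert v) := by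
  refine Int.mul_ediv_cancel' ?_
  rw [← map_sum]
  have h := K.2 (∑ v ∈ I, vert v)
  have h2 := Int.modEq_iff_dvd.1 h
  omega

/-- The minimal `G`-weight `g([K, E]) = min {f([K, I]) | I ⊆ E}`. -/
def minWeight (K : G.Char) (E : Finset V) : ℤ :=
  E.powerset.inf' E.powerset_nonempty (weight K)

/-- `A_v([K, E]) = g([K, E - v])`. -/
def aMin (K : G.Char) (E : Finset V) (v : V) : ℤ := minWeight K (E.erase v)

/-- For `v ∈ E`, `B_v([K, E]) = min {f([K, I]) | v ∈ I ⊆ E}`; the sets `I` in question are the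
`J ∪ {v}` with `J ⊆ E - v`. -/
def bMin (K : G.Char) (E : Finset V) (v : V) : ℤ :=
  (E.erase v).powerset.inf' (E.erase v).powerset_nonempty (fun J => weight K (insert v J))

/-- The exponent `a_v[K, E] = A_v([K, E]) - g([K, E])`, which is nonnegative for `v ∈ E`. -/
def aExp (K : G.Char) (E : Finset V) (v : V) : ℕ := (aMin K E v - minWeight K E).toNat

/-- The exponent `b_v[K, E] = B_v([K, E]) - g([K, E])`, which is nonnegative for `v ∈ E`. -/
def bExp (K : G.Char) (E : Finset V) (v : V) : ℕ := (bMin K E v - minWeight K E).toNat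

theorem coe_aExp (K : G.Char) (E : Finset V) (v : V) :
    (aExp K E v : ℤ) = minWeight K (E.erase v) - minWeight K E := by
  have h : minWeight K E ≤ minWeight K (E.erase v) :=
    Finset.inf'_mono _ (Finset.powerset_mono.2 (E.erase_subset v)) _
  rw [aExp, aMin, Int.toNat_of_nonneg (sub_nonneg.2 h)]

theorem two_mul_weight_singleton (K : G.Char) (v : V) :
    2 * weight K {v} = K.1 (vert v) + G.form (vert v) (vert v) := by
  simp [two_mul_weight]

theorem form_comm (x y : V → ℤ) : G.form x y = G.form y x := by
  have h : G.incidence.transpose = G.incidence := by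
    ext v w
    simp only [incidence, Matrix.transpose_apply, Matrix.of_apply]
    by_cases e : v = w
    · simp [e]
    · simp only [e, Ne.symm e, if_false]
      by_cases a : G.graph.Adj v w
      · rw [if_pos a, if_pos a.symm]
      · rw [if_neg a, if_neg fun b => a b.symm]
  simp only [form, Matrix.toBilin'_apply']
  rw [Matrix.dotProduct_mulVec, ← Matrix.mulVec_transpose, h, dotProduct_comm]

theorem weight_insert (K : G.Char) {J : Finset V} {v : V} (hv : v ∉ J) :
    weight K (insert v J) = weight K {v} + weight (K.shift v) J := by
  have h1 := two_mul_weight K (insert v J)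
  have h2 := two_mul_weight_singleton K v
  have h3 := two_mul_weight (K.shift v) J
  rw [Finset.sum_insert hv, Finset.sum_insert hv] at h1
  rw [← map_sum] at h1 h3
  simp only [Char.shift, LinearMap.add_apply, LinearMap.smul_apply, smul_eq_mul, map_add] at h1 h3
  have h4 := form_comm (G := G) (∑ v ∈ J, vert v) (vert v)
  simp only [Char.shift]
  linarith

theorem bMin_eq (K : G.Char) (E : Finset V) (v : V) :
    bMin K E v = weight K {v} + minWeight (K.shift v) (E.erase v) := by
  have h : bMin K E v = (E.erase v).powerset.inf' (E.erase v).powerset_nonempty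
      (fun J => weight K {v} + weight (K.shift v) J) := by
    refine Finset.inf'_congr _ rfl fun J hJ => weight_insert K fun hv => ?_
    exact Finset.notMem_erase v E (Finset.mem_powerset.1 hJ hv)
  rw [h, minWeight]
  exact (Finset.apply_inf'_eq_inf'_comp (E.erase v).powerset_nonempty
    (g := fun x : ℤ => weight K {v} + x)
    (fun x y => (min_add_add_left (weight K {v}) x y).symm)).symm

theorem coe_bExp (K : G.Char) {E : Finset V} {v : V} (hv : v ∈ E) :
    (bExp K E v : ℤ) =
      weight K {v} + minWeight (K.shift v) (E.erase v) - minWeight K E := by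
  have h : minWeight K E ≤ bMin K E v := by
    refine Finset.le_inf' _ _ fun J hJ => Finset.inf'_le _ (Finset.mem_powerset.2 ?_)
    exact Finset.insert_subset hv ((Finset.mem_powerset.1 hJ).trans (E.erase_subset v))
  rw [bExp, Int.toNat_of_nonneg (sub_nonneg.2 h), bMin_eq]

theorem Char.shift_comm (K : G.Char) (v w : V) : (K.shift v).shift w = (K.shift w).shift v :=
  Subtype.ext (add_right_comm _ _ _)

theorem weight_shift (K : G.Char) (v w : V) :
    weight (K.shift v) {w} = weight K {w} + G.form (vert v) (vert w) := by
  have h1 := two_mul_weight_singleton K w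
  have h2 := two_mul_weight_singleton (K.shift v) w
  simp only [Char.shift, LinearMap.add_apply, LinearMap.smul_apply, smul_eq_mul] at h2
  simp only [Char.shift]
  linarith

variable (G)

/-- The characteristic elements `K` with `𝔰_K = 𝔰`. -/
def CharIn (s : G.SpinC) : Type _ := {K : G.Char // K.spinc = s}

variable {G}

/-- `K ↦ K + 2 v^*` preserves the induced spin^c structure. -/
def CharIn.shift {s : G.SpinC} (K : G.CharIn s) (v : V) : G.CharIn s :=
  ⟨K.1.shift v, (K.1.spinc_shift v).trans K.2⟩

variable (G)

/-- The lattice chain complex `CF⁻(G, 𝔰)`: the free `𝔽₂[U]`-module on the pairs `[K, E]` with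
`𝔰_K = 𝔰`. The variable `U` is `X : (ZMod 2)[X]`. -/
abbrev CF (s : G.SpinC) : Type _ := (G.CharIn s × Finset V) →₀ (ZMod 2)[X]

variable {G}

/-- The generator `[K, E]`. -/
def gen {s : G.SpinC} (K : G.CharIn s) (E : Finset V) : G.CF s := Finsupp.single (K, E) 1

/-- `∂[K, E] = ∑_{v ∈ E} (U^{a_v[K, E]} [K, E - v] + U^{b_v[K, E]} [K + 2 v^*, E - v])`. -/
def bdryGen {s : G.SpinC} (K : G.CharIn s) (E : Finset V) : G.CF s :=
  ∑ v ∈ E, ((X : (ZMod 2)[X]) ^ aExp K.1 E v • gen K (E.erase v) +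
    (X : (ZMod 2)[X]) ^ bExp K.1 E v • gen (K.shift v) (E.erase v))

variable (G)

/-- The boundary map of `CF⁻(G, 𝔰)`. -/
def bdry (s : G.SpinC) : G.CF s →ₗ[(ZMod 2)[X]] G.CF s :=
  Finsupp.linearCombination (ZMod 2)[X] fun p => bdryGen p.1 p.2

theorem bdry_gen {s : G.SpinC} (K : G.CharIn s) (E : Finset V) :
    G.bdry s (gen K E) = bdryGen K E := by
  simp [bdry, gen]

theorem bdry_bdry (s : G.SpinC) : G.bdry s ∘ₗ G.bdry s = 0 := by
  refine Finsupp.lhom_ext' fun p => LinearMap.ext_ring ?_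
  obtain ⟨K, E⟩ := p
  change G.bdry s (G.bdry s (gen K E)) = 0
  let T : V → V → G.CF s := fun v w =>
    ((X : (ZMod 2)[X]) ^ (aExp K.1 E v + aExp K.1 (E.erase v) w) •
        gen K ((E.erase v).erase w) +
      (X : (ZMod 2)[X]) ^ (aExp K.1 E v + bExp K.1 (E.erase v) w) •
        gen (K.shift w) ((E.erase v).erase w)) +
    ((X : (ZMod 2)[X]) ^ (bExp K.1 E v + aExp (K.shift v).1 (E.erase v) w) •
        gen (K.shift v) ((E.erase v).erase w) +
      (X : (ZMod 2)[X]) ^ (bExp K.1 E v + bExp (K.shift v).1 (E.erase v) w) •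
        gen ((K.shift v).shift w) ((E.erase v).erase w))
  have hT : G.bdry s (G.bdry s (gen K E)) = ∑ v ∈ E, ∑ w ∈ E.erase v, T v w := by
    rw [bdry_gen, bdryGen, map_sum]
    refine Finset.sum_congr rfl fun v _ => ?_
    rw [map_add, map_smul, map_smul, bdry_gen, bdry_gen, bdryGen, bdryGen, Finset.smul_sum,
      Finset.smul_sum, ← Finset.sum_add_distrib]
    refine Finset.sum_congr rfl fun w _ => ?_
    simp only [T, smul_add, smul_smul, ← pow_add]
  have hsymm : ∀ v ∈ E, ∀ w ∈ E, v ≠ w → T v w = T w v := by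
    intro v hv w hw hvw
    have hvw' : v ∈ E.erase w := Finset.mem_erase.2 ⟨hvw, hv⟩
    have hwv' : w ∈ E.erase v := Finset.mem_erase.2 ⟨hvw.symm, hw⟩
    have hE : (E.erase v).erase w = (E.erase w).erase v := Finset.erase_right_comm
    have hK : (K.shift v).shift w = (K.shift w).shift v := Subtype.ext (K.1.shift_comm v w)
    have hs : ∀ u, (K.shift u).1 = K.1.shift u := fun _ => rfl
    have e1 : aExp K.1 E v + aExp K.1 (E.erase v) w = aExp K.1 E w + aExp K.1 (E.erase w) v := by
      zify
      simp only [coe_aExp, hE]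
      ring
    have e2 : ∀ v ∈ E, ∀ w ∈ E, v ∈ E.erase w → w ∈ E.erase v →
        aExp K.1 E v + bExp K.1 (E.erase v) w =
          bExp K.1 E w + aExp (K.shift w).1 (E.erase w) v := by
      intro v hv w hw h1 h2
      zify
      rw [coe_aExp, coe_aExp, coe_bExp _ h2, coe_bExp _ hw, hs,
        Finset.erase_right_comm (a := v) (b := w)]
      ring
    have e3 : bExp K.1 E v + bExp (K.shift v).1 (E.erase v) w =
        bExp K.1 E w + bExp (K.shift w).1 (E.erase w) v := by
      zify
      rw [coe_bExp _ hv, coe_bExp _ hw, coe_bExp _ hwv', coe_bExp _ hvw', hs, hs, hE,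
        Char.shift_comm, weight_shift, weight_shift, form_comm (vert v)]
      ring
    simp only [T]
    rw [e1, e2 v hv w hw hvw' hwv', ← e2 w hw v hv hwv' hvw', e3, hE, hK]
    abel
  rw [hT, Finset.sum_sigma']
  refine Finset.sum_involution (fun p _ => ⟨p.2, p.1⟩) ?_ ?_ ?_ ?_
  · rintro ⟨v, w⟩ h
    simp only [Finset.mem_sigma, Finset.mem_erase] at h
    simp only
    rw [hsymm v h.1 w h.2.2 h.2.1.symm, ← two_smul (ZMod 2)[X] (T w v),
      show (2 : (ZMod 2)[X]) = 0 from CharTwo.two_eq_zero, zero_smul]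
  · rintro ⟨v, w⟩ h _ heq
    simp only [Finset.mem_sigma, Finset.mem_erase] at h
    exact h.2.1 (congrArg Sigma.fst heq)
  · rintro ⟨v, w⟩ h
    simp only [Finset.mem_sigma, Finset.mem_erase] at h ⊢
    exact ⟨h.2.2, h.2.1.symm, h.1⟩
  · rintro ⟨v, w⟩ _
    rfl

/-- The lattice homology `HF⁻(G, 𝔰)`, an `𝔽₂[U]`-module. -/
abbrev HF (s : G.SpinC) : Type _ := SqZero.Homology (G.bdry s) (G.bdry_bdry s)

/-- `CF⁻_k(G, 𝔰)`: the chains of `δ`-degree `k`, spanned by the `[K, E]` with `|E| = k`. -/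
def CFdeg (s : G.SpinC) (k : ℕ) : Submodule (ZMod 2)[X] (G.CF s) :=
  Finsupp.supported (ZMod 2)[X] (ZMod 2)[X] {p | p.2.card = k}

/-- `HF⁻_k(G, 𝔰) ⊆ HF⁻(G, 𝔰)`: the classes of the cycles of `δ`-degree `k`. -/
def HFdeg (s : G.SpinC) (k : ℕ) : Submodule (ZMod 2)[X] (G.HF s) :=
  SqZero.classesOf (G.bdry s) (G.bdry_bdry s) (G.CFdeg s k)

end

end PlumbingGraph

/-! Fix `K` in the given spin^c class. By nondegeneracy, x ↦ K + 2x^* is a bijection from ℤ^V to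
that class, and [K + 2x^*, E] becomes the cube with lowest vertex x and directions E. With w(x) =
(K(x) + x·x)/2 one has f([K + 2x^*, I]) = w(x + ∑_{v ∈ I} v) - w(x), so the exponents of U are
differences of minimal weights of cubes (`height_cubeCenter`), and CF⁻ is a weighted cubical chain
complex of ℝ^V (`cubeIso_bdry`).

If the weight never drops when stepping inwards from one side of a box, a chain homotopy collapses
that layer (`IsPush.single_mem`). Negative definiteness yields a vector Z with positive coordinates
and Z·v < 0 for all v; comparison with multiples of Z finds such a side on every box that exceeds a
fixed one (`NegDef.exists_box`). So every cycle is homologous to a chain in one finite box, and HF⁻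
is finitely generated because 𝔽[U] is Noetherian.

If the weight drops by at most N, the collapse still works after multiplication by U^N. Hence some
power of U makes any given cycle homologous to a multiple of a point
(`exists_pow_homologous_single`), and the augmentation detects that multiple. It equals 1 at a
lattice point of maximal weight, so on homology it splits off a free summand generated in δ-degree
0. Its kernel is finitely generated and U-power torsion, hence a sum of modules 𝔽[U]/(U^n). -/

/-! ### Cubes, heights and the weighted boundary -/

namespace CubeComplex

noncomputable section

variable {V : Type*} [Fintype V] [DecidableEq V] (w : (V → ℤ) → ℤ)

/-- The lattice points that are vertices of the cube with centre `c / 2`. -/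
def vertices (c : V → ℤ) : Finset (V → ℤ) :=
  Finset.Icc (fun u => c u / 2) (fun u => (c u + 1) / 2)

theorem mem_vertices {c y : V → ℤ} :
    y ∈ vertices c ↔ ∀ u, c u / 2 ≤ y u ∧ y u ≤ (c u + 1) / 2 := by
  simp [vertices, Pi.le_def, forall_and]

theorem vertices_nonempty (c : V → ℤ) : (vertices c).Nonempty :=
  ⟨fun u => c u / 2, mem_vertices.2 fun u => by omega⟩

/-- The height of a cube: the minimal weight of its vertices. -/
def height (c : V → ℤ) : ℤ := (vertices c).inf' (vertices_nonempty c) w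

variable {w} in
theorem le_height {c : V → ℤ} {n : ℤ} : n ≤ height w c ↔ ∀ y ∈ vertices c, n ≤ w y :=
  Finset.le_inf'_iff _ _

theorem height_le {c y : V → ℤ} (h : y ∈ vertices c) : height w c ≤ w y :=
  le_height.1 le_rfl y h

theorem height_two_mul (y : V → ℤ) : height w (fun u => 2 * y u) = w y := by
  refine le_antisymm (height_le w (mem_vertices.2 fun u => by omega)) (le_height.2 fun z hz => ?_)
  have : z = y := funext fun u => by have := mem_vertices.1 hz u; omega
  rw [this]

/-- A face has fewer vertices, so its minimum is larger. This keeps the exponents in the boundary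
from being truncated by `toNat`. -/
theorem height_le_height_face {c : V → ℤ} {v : V} (hv : Odd (c v)) {t : ℤ}
    (ht : t = 1 ∨ t = -1) : height w c ≤ height w (c + Pi.single v t) := by
  refine le_height.2 fun y hy => height_le w (mem_vertices.2 fun u => ?_)
  have h := mem_vertices.1 hy u
  obtain ⟨k, hk⟩ := hv
  by_cases e : u = v
  · subst e
    simp only [Pi.add_apply, Pi.single_eq_same] at h
    omega
  · simpa [Pi.single_eq_of_ne e] using h

/-- The generator at `c'`, with the power of `X` that makes `c ↦ move w N c c'` homogeneous of
degree `-N` with respect to the height. -/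
def move (N : ℤ) (c c' : V → ℤ) : (V → ℤ) →₀ (ZMod 2)[X] :=
  Finsupp.single c' (X ^ (N + height w c' - height w c).toNat)

/-- The boundary of a cube. -/
def bdryCube (c : V → ℤ) : (V → ℤ) →₀ (ZMod 2)[X] :=
  ∑ v with Odd (c v),
    (move w 0 c (c + Pi.single v 1) + move w 0 c (c + Pi.single v (-1)))

/-- The boundary map. -/
def bdry : ((V → ℤ) →₀ (ZMod 2)[X]) →ₗ[(ZMod 2)[X]] ((V → ℤ) →₀ (ZMod 2)[X]) :=
  Finsupp.linearCombination _ (bdryCube w)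

theorem bdry_single (c : V → ℤ) : bdry w (Finsupp.single c 1) = bdryCube w c := by
  simp [bdry]

variable {w} in
theorem map_move {M : Type*} [AddCommGroup M] [Module (ZMod 2)[X] M]
    (L : ((V → ℤ) →₀ (ZMod 2)[X]) →ₗ[(ZMod 2)[X]] M) (N : ℤ) (c c' : V → ℤ) :
    L (move w N c c') =
      (X : (ZMod 2)[X]) ^ (N + height w c' - height w c).toNat • L (Finsupp.single c' 1) := by
  rw [move, ← map_smul, Finsupp.smul_single, smul_eq_mul, mul_one]

variable {w} in
-- Exponents telescope; the two hypotheses say that neither is truncated.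
theorem smul_move {N N' : ℤ} {c c' c'' : V → ℤ} (h : height w c ≤ N + height w c')
    (h' : height w c' ≤ N' + height w c'') :
    (X : (ZMod 2)[X]) ^ (N + height w c' - height w c).toNat • move w N' c' c'' =
      move w (N + N') c c'' := by
  rw [move, move, Finsupp.smul_single, smul_eq_mul, ← pow_add]
  congr 2
  omega

theorem move_self (N : ℕ) (c : V → ℤ) :
    move w N c c = (X : (ZMod 2)[X]) ^ N • Finsupp.single c 1 := by
  simp [move]

theorem char_two_add_self {M : Type*} [AddCommGroup M] [Module (ZMod 2)[X] M] (x : M) :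
    x + x = 0 := by
  rw [← two_smul (ZMod 2)[X] x, show (2 : (ZMod 2)[X]) = 0 from CharTwo.two_eq_zero, zero_smul]

/-! ### Collapsing a layer of cubes -/

/-- The homotopy that pushes the cubes with `c v = 2 β` into the direction `-s` of the
coordinate `v`. -/
def push (v : V) (β s : ℤ) (N : ℕ) :
    ((V → ℤ) →₀ (ZMod 2)[X]) →ₗ[(ZMod 2)[X]] ((V → ℤ) →₀ (ZMod 2)[X]) :=
  Finsupp.linearCombination _ fun c => if c v = 2 * β then move w N c (c - Pi.single v s) else 0

theorem push_single (v : V) (β s : ℤ) (N : ℕ) (c : V → ℤ) :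
    push w v β s N (Finsupp.single c 1) =
      if c v = 2 * β then move w N c (c - Pi.single v s) else 0 := by
  simp [push]

/-- Lets pushes in both directions be treated at once. -/
theorem bdryCube_eq_signs {s : ℤ} (hs : s = 1 ∨ s = -1) (c : V → ℤ) :
    bdryCube w c = ∑ v with Odd (c v),
      (move w 0 c (c + Pi.single v s) + move w 0 c (c + Pi.single v (-s))) := by
  obtain rfl | rfl := hs
  · rfl
  · simp only [neg_neg, bdryCube]
    exact Finset.sum_congr rfl fun v _ => add_comm _ _

/-- Hypotheses under which the set `P` of cubes can be pushed into `Q`. -/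
structure IsPush (P Q : Set (V → ℤ)) (v : V) (β s : ℤ) (N : ℕ) : Prop where
  sign : s = 1 ∨ s = -1
  face : ∀ c ∈ P, ∀ u, Odd (c u) → ∀ t : ℤ, t = 1 ∨ t = -1 → c + Pi.single u t ∈ P
  bound : ∀ c ∈ P, s * c v ≤ s * (2 * β)
  height_le : ∀ c ∈ P, c v = 2 * β → height w c ≤ N + height w (c - Pi.single v s)
  mem_of_lt : ∀ c ∈ P, c v ≠ 2 * β → c v ≠ 2 * β - s → c ∈ Q
  mem_of_eq : ∀ c ∈ P, c v = 2 * β → c - Pi.single v (2 * s) ∈ Q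

variable {w}

/-- The homotopy formula has three cases. For a cube in the hyperplane, the boundary of its
thickening consists of the cube, the opposite face and side faces; the side faces cancel against the
pushed boundary, and only the opposite face survives. A cube with `c v = 2 * β - s` has one face in
the hyperplane, whose thickening is the cube again, so everything cancels. The remaining cubes do
not meet the homotopy. -/
theorem IsPush.single_mem {P Q : Set (V → ℤ)} {v : V} {β s : ℤ} {N : ℕ}
    (H : IsPush w P Q v β s N) {c : V → ℤ} (hc : c ∈ P) :
    (X : (ZMod 2)[X]) ^ N • Finsupp.single c 1 + bdry w (push w v β s N (Finsupp.single c 1)) +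
      push w v β s N (bdry w (Finsupp.single c 1)) ∈
        Finsupp.supported (ZMod 2)[X] (ZMod 2)[X] Q := by
  have hs := H.sign
  have hns : -s = 1 ∨ -s = -1 := by omega
  rw [bdry_single, push_single]
  by_cases h1 : c v = 2 * β
  · -- a cube in the hyperplane
    set c' := c - Pi.single v s with hc'
    have hc'v : Odd (c' v) := by
      simp only [hc', Pi.sub_apply, Pi.single_eq_same, h1]
      rcases hs with rfl | rfl
      · exact ⟨β - 1, by ring⟩
      · exact ⟨β, by ring⟩
    have hc'u : ∀ u, u ≠ v → c' u = c u := fun u hu => by simp [hc', hu]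
    have hcv : ¬ Odd (c v) := by rw [h1, Int.not_odd_iff_even]; exact even_two_mul β
    have hF : Finset.univ.filter (fun u => Odd (c' u)) =
        insert v (Finset.univ.filter fun u => Odd (c u)) := by
      ext u
      by_cases hu : u = v
      · subst hu; simp [hc'v]
      · simp [hc'u u hu, hu]
    have hH := H.height_le c hc h1
    rw [if_pos h1, map_move, bdry_single, bdryCube_eq_signs w hs, hF,
      Finset.sum_insert (by simp [hcv]), smul_add, smul_add, Finset.smul_sum,
      smul_move hH (by simpa using height_le_height_face w hc'v hs),
      smul_move hH (by simpa using height_le_height_face w hc'v hns),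
      bdryCube_eq_signs w hs, map_sum]
    have e1 : c' + Pi.single v s = c := by simp [hc']
    have e2 : c' + Pi.single v (-s) = c - Pi.single v (2 * s) := by
      rw [hc', two_mul, Pi.single_add, Pi.single_neg]; abel
    -- Side faces of the thickening are thickenings of faces.
    have e3 : ∀ u ∈ Finset.univ.filter (fun u => Odd (c u)),
        (X : (ZMod 2)[X]) ^ ((N : ℤ) + height w c' - height w c).toNat •
            (move w 0 c' (c' + Pi.single u s) + move w 0 c' (c' + Pi.single u (-s))) =
          push w v β s N (move w 0 c (c + Pi.single u s) + move w 0 c (c + Pi.single u (-s))) := by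
      intro u hu
      have huc : Odd (c u) := by simpa using hu
      have huv : u ≠ v := fun e => hcv (e ▸ huc)
      have huc' : Odd (c' u) := by rwa [hc'u u huv]
      have key : ∀ t : ℤ, t = 1 ∨ t = -1 →
          (X : (ZMod 2)[X]) ^ ((N : ℤ) + height w c' - height w c).toNat •
            move w 0 c' (c' + Pi.single u t) =
          push w v β s N (move w 0 c (c + Pi.single u t)) := by
        intro t ht
        have hv' : (c + Pi.single u t : V → ℤ) v = 2 * β := by simp [huv.symm, h1]
        have e4 : c + Pi.single u t - Pi.single v s = c' + Pi.single u t := by rw [hc']; abel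
        rw [smul_move hH (by simpa using height_le_height_face w huc' ht), map_move, push_single,
          if_pos hv', e4, smul_move (by simpa using height_le_height_face w huc ht), add_comm]
        rw [← e4]
        exact H.height_le _ (H.face c hc u huc t ht) hv'
      rw [smul_add, map_add, key s hs, key (-s) hns]
    rw [Finset.sum_congr rfl e3, e1, e2, add_zero, move_self]
    set A := (X : (ZMod 2)[X]) ^ N • (Finsupp.single c 1 : (V → ℤ) →₀ (ZMod 2)[X])
    set B := move w (N : ℤ) c (c - Pi.single v (2 * s))
    set S := ∑ u with Odd (c u),
      push w v β s N (move w 0 c (c + Pi.single u s) + move w 0 c (c + Pi.single u (-s)))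
    have : A + (A + B + S) + S = B + ((A + A) + (S + S)) := by abel
    rw [this, char_two_add_self, char_two_add_self, add_zero, add_zero]
    exact Finsupp.single_mem_supported _ _ (H.mem_of_eq c hc h1)
  · rw [if_neg h1, map_zero, add_zero, bdryCube_eq_signs w hs, map_sum]
    have hb := H.bound c hc
    -- A face of a cube off the hyperplane can enter it only from `c v = 2 * β - s` in direction
    -- `s`; `bound` rules out the other side.
    have hz : ∀ u, Odd (c u) → ∀ t : ℤ, t = 1 ∨ t = -1 → (u = v → t = s → c v ≠ 2 * β - s) →
        push w v β s N (move w 0 c (c + Pi.single u t)) = 0 := by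
      intro u hu t ht hne
      rw [map_move, push_single, if_neg, smul_zero]
      by_cases huv : u = v
      · subst huv
        simp only [Pi.add_apply, Pi.single_eq_same]
        intro h
        rcases hs with rfl | rfl <;> rcases ht with rfl | rfl <;> simp at hne <;> omega
      · simpa [Ne.symm huv] using h1
    by_cases h2 : c v = 2 * β - s
    · -- a cube that is collapsed
      have hcv : Odd (c v) := by
        rw [h2]
        rcases hs with rfl | rfl
        · exact ⟨β - 1, by ring⟩
        · exact ⟨β, by ring⟩
      have hv' : (c + Pi.single v s : V → ℤ) v = 2 * β := by simp [h2]
      have hH := H.height_le _ (H.face c hc v hcv s hs) hv'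
      rw [add_sub_cancel_right] at hH
      rw [Finset.sum_eq_single_of_mem v (by simp [hcv]), map_add,
        hz v hcv (-s) hns (fun _ h => by omega), map_move, push_single, if_pos hv',
        add_sub_cancel_right, smul_move (by simpa using height_le_height_face w hcv hs) hH,
        zero_add, move_self, add_zero, char_two_add_self]
      · exact zero_mem _
      · intro u hu huv
        have hu' : Odd (c u) := by simpa using hu
        rw [map_add, hz u hu' s hs (fun h => absurd h huv), hz u hu' (-s) hns (fun h => absurd h huv),
          add_zero]
    · rw [Finset.sum_eq_zero, add_zero]
      · exact Submodule.smul_mem _ _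
          (Finsupp.single_mem_supported _ _ (H.mem_of_lt c hc h1 h2))
      · intro u hu
        have hu' : Odd (c u) := by simpa using hu
        rw [map_add, hz u hu' s hs (fun _ _ => h2), hz u hu' (-s) hns (fun _ _ => h2), add_zero]

theorem IsPush.mem {P Q : Set (V → ℤ)} {v : V} {β s : ℤ} {N : ℕ} (H : IsPush w P Q v β s N)
    {z : (V → ℤ) →₀ (ZMod 2)[X]} (hz : z ∈ Finsupp.supported (ZMod 2)[X] (ZMod 2)[X] P) :
    (X : (ZMod 2)[X]) ^ N • z + bdry w (push w v β s N z) + push w v β s N (bdry w z) ∈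
      Finsupp.supported (ZMod 2)[X] (ZMod 2)[X] Q := by
  let L : ((V → ℤ) →₀ (ZMod 2)[X]) →ₗ[(ZMod 2)[X]] ((V → ℤ) →₀ (ZMod 2)[X]) :=
    (X : (ZMod 2)[X]) ^ N • LinearMap.id + bdry w ∘ₗ push w v β s N + push w v β s N ∘ₗ bdry w
  suffices Finsupp.supported (ZMod 2)[X] (ZMod 2)[X] P ≤
      (Finsupp.supported (ZMod 2)[X] (ZMod 2)[X] Q).comap L from this hz
  rw [Finsupp.supported_eq_span_single, Submodule.span_le]
  rintro _ ⟨c, hc, rfl⟩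
  exact H.single_mem hc

/-- A cycle in `P` is, up to a power of `X`, homologous to a chain in `Q`. -/
theorem IsPush.exists_homologous {P Q : Set (V → ℤ)} {v : V} {β s : ℤ} {N : ℕ}
    (H : IsPush w P Q v β s N) {z : (V → ℤ) →₀ (ZMod 2)[X]}
    (hz : z ∈ Finsupp.supported (ZMod 2)[X] (ZMod 2)[X] P) (hd : bdry w z = 0) :
    ∃ z' ∈ Finsupp.supported (ZMod 2)[X] (ZMod 2)[X] Q,
      ∃ y, z' = (X : (ZMod 2)[X]) ^ N • z + bdry w y :=
  ⟨_, by simpa [hd] using H.mem hz, _, rfl⟩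

/-! ### Shrinking boxes -/

/-- The cubes contained in the box with corners `a` and `b`. -/
def box (a b : V → ℤ) : Set (V → ℤ) := {c | ∀ u, 2 * a u ≤ c u ∧ c u ≤ 2 * b u}

theorem box_finite (a b : V → ℤ) : (box a b).Finite :=
  (Set.finite_Icc (fun u => 2 * a u) (fun u => 2 * b u)).subset fun _ hc =>
    ⟨fun u => (hc u).1, fun u => (hc u).2⟩

/-- The bounds of a box are even, so an odd coordinate lies strictly between them. -/
theorem add_single_mem_box {a b c : V → ℤ} (hc : c ∈ box a b) {u : V} (hu : Odd (c u)) {t : ℤ}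
    (ht : t = 1 ∨ t = -1) : c + Pi.single u t ∈ box a b := by
  intro i
  have h := hc i
  by_cases e : i = u
  · subst e
    obtain ⟨k, hk⟩ := hu
    simp only [Pi.add_apply, Pi.single_eq_same]
    constructor <;> omega
  · simpa [e] using h

/-- Each vertex of the thickened cube is a vertex of `c` or one step inwards from such a vertex, so
a bound on lattice points suffices. -/
theorem height_le_of_forall {a b c : V → ℤ} {v : V} {β s : ℤ} {N : ℕ} (hs : s = 1 ∨ s = -1)
    (hw : ∀ y ∈ Set.Icc a b, y v = β → w y ≤ N + w (y - Pi.single v s))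
    (hc : c ∈ box a b) (hcv : c v = 2 * β) :
    height w c ≤ N + height w (c - Pi.single v s) := by
  rw [← sub_le_iff_le_add']
  refine le_height.2 fun y hy => ?_
  rw [sub_le_iff_le_add']
  rw [mem_vertices] at hy
  have hv := hy v
  simp only [Pi.sub_apply, Pi.single_eq_same, hcv] at hv
  have hne : ∀ u, u ≠ v → c u / 2 ≤ y u ∧ y u ≤ (c u + 1) / 2 := fun u hu => by
    simpa [hu] using hy u
  by_cases e : y v = β
  · refine (height_le w (y := y) (mem_vertices.2 fun u => ?_)).trans (by omega)
    by_cases hu : u = v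
    · subst hu; omega
    · exact hne u hu
  · have hmem : y + Pi.single v s ∈ vertices c := mem_vertices.2 fun u => by
      by_cases hu : u = v
      · subst hu
        simp only [Pi.add_apply, Pi.single_eq_same]
        omega
      · simpa [hu] using hne u hu
    have h := mem_vertices.1 hmem
    have := hw (y + Pi.single v s)
      ⟨fun u => (by have := hc u; omega : a u ≤ c u / 2).trans (h u).1,
        fun u => (h u).2.trans (by have := hc u; omega : (c u + 1) / 2 ≤ b u)⟩
      (by have := h v; omega)
    rw [add_sub_cancel_right] at this
    exact (height_le w hmem).trans this

theorem isPush_down {a b : V → ℤ} {v : V} {N : ℕ} (hv : a v < b v)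
    (hw : ∀ y ∈ Set.Icc a b, y v = b v → w y ≤ N + w (y - Pi.single v 1)) :
    IsPush w (box a b) (box a (b - Pi.single v 1)) v (b v) 1 N where
  sign := Or.inl rfl
  face _ hc _ hu _ ht := add_single_mem_box hc hu ht
  bound c hc := by have := hc v; omega
  height_le _ hc hcv := height_le_of_forall (Or.inl rfl) hw hc hcv
  mem_of_lt c hc h1 h2 u := by
    have := hc u
    by_cases hu : u = v
    · subst hu; simp only [Pi.sub_apply, Pi.single_eq_same]; constructor <;> omega
    · simpa [hu] using this
  mem_of_eq c hc h u := by
    have := hc u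
    by_cases hu : u = v
    · subst hu; simp only [Pi.sub_apply, Pi.single_eq_same]; constructor <;> omega
    · simpa [hu] using this

theorem isPush_up {a b : V → ℤ} {v : V} {N : ℕ} (hv : a v < b v)
    (hw : ∀ y ∈ Set.Icc a b, y v = a v → w y ≤ N + w (y + Pi.single v 1)) :
    IsPush w (box a b) (box (a + Pi.single v 1) b) v (a v) (-1) N where
  sign := Or.inr rfl
  face _ hc _ hu _ ht := add_single_mem_box hc hu ht
  bound c hc := by have := hc v; omega
  height_le _ hc hcv := height_le_of_forall (Or.inr rfl)
    (fun y hy h => by simpa [Pi.single_neg] using hw y hy h) hc hcv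
  mem_of_lt c hc h1 h2 u := by
    have := hc u
    by_cases hu : u = v
    · subst hu; simp only [Pi.add_apply, Pi.single_eq_same]; constructor <;> omega
    · simpa [hu] using this
  mem_of_eq c hc h u := by
    have := hc u
    by_cases hu : u = v
    · subst hu
      simp only [Pi.add_apply, Pi.sub_apply, Pi.single_eq_same]; constructor <;> omega
    · simpa [hu] using this

end

end CubeComplex

namespace CubeComplex

noncomputable section

variable {V : Type*} [Fintype V] [DecidableEq V] {w : (V → ℤ) → ℤ}

theorem exists_mem_supported_box (z : (V → ℤ) →₀ (ZMod 2)[X]) (a₀ b₀ : V → ℤ) :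
    ∃ a ≤ a₀, ∃ b, b₀ ≤ b ∧ z ∈ Finsupp.supported (ZMod 2)[X] (ZMod 2)[X] (box a b) := by
  obtain ⟨l, hl⟩ := z.support.bddBelow
  obtain ⟨m, hm⟩ := z.support.bddAbove
  refine ⟨fun u => min (a₀ u) (l u / 2), fun u => min_le_left _ _,
    fun u => max (b₀ u) ((m u + 1) / 2), fun u => le_max_left _ _, fun c hc u => ?_⟩
  have h1 : l u ≤ c u := hl hc u
  have h2 : c u ≤ m u := hm hc u
  dsimp only
  constructor <;> omega

theorem sum_sub_single (f g : V → ℤ) (v : V) :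
    ∑ u, ((f - Pi.single v 1 : V → ℤ) u - g u) = ∑ u, (f u - g u) - 1 := by
  simp [Finset.sum_sub_distrib]
  ring

theorem eq_of_sum_eq_zero {f g : V → ℤ} (h : g ≤ f) (h0 : ∑ u, (f u - g u) = 0) : f = g := by
  refine funext fun u => sub_eq_zero.1 ?_
  exact (Finset.sum_eq_zero_iff_of_nonneg fun u _ => sub_nonneg.2 (h u)).1 h0 u (Finset.mem_univ u)

theorem le_sub_single {f g : V → ℤ} (h : g ≤ f) {v : V} (hv : g v < f v) :
    g ≤ f - Pi.single v 1 := by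
  intro u
  have : g u ≤ f u := h u
  by_cases e : u = v
  · subst e; simp only [Pi.sub_apply, Pi.single_eq_same]; omega
  · simpa [e] using this

/-- Layers are peeled off with `N = 0`, so no power of `X` is lost. The induction is on the total
excess of `b` over `b₀`. -/
theorem exists_homologous_down (hd : ∀ x, bdry w (bdry w x) = 0) {a b₀ : V → ℤ} (hab : a ≤ b₀)
    (hstep : ∀ b, b₀ ≤ b → b ≠ b₀ → ∃ v, b₀ v < b v ∧
      ∀ y ≤ b, y v = b v → w y ≤ w (y - Pi.single v 1))
    {b : V → ℤ} (hb : b₀ ≤ b) {z : (V → ℤ) →₀ (ZMod 2)[X]} (hz : bdry w z = 0)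
    (hzb : z ∈ Finsupp.supported (ZMod 2)[X] (ZMod 2)[X] (box a b)) :
    ∃ z' ∈ Finsupp.supported (ZMod 2)[X] (ZMod 2)[X] (box a b₀), ∃ y, z' = z + bdry w y := by
  obtain ⟨n, hn⟩ : ∃ n : ℕ, ∑ u, (b u - b₀ u) = n :=
    ⟨_, (Int.toNat_of_nonneg (Finset.sum_nonneg fun u _ => sub_nonneg.2 (hb u))).symm⟩
  induction n generalizing b z with
  | zero =>
    obtain rfl := eq_of_sum_eq_zero hb hn
    exact ⟨z, hzb, 0, by simp⟩
  | succ n ih =>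
    obtain ⟨v, hv, hw⟩ := hstep b hb (by rintro rfl; simp at hn; omega)
    obtain ⟨z', hz', y, hy⟩ := (isPush_down (N := 0) ((hab v).trans_lt hv)
      fun y hy h => by simpa using hw y hy.2 h).exists_homologous hzb hz
    rw [pow_zero, one_smul] at hy
    obtain ⟨z'', hz'', y', hy'⟩ := ih (le_sub_single hb hv) (by rw [hy, map_add, hz, hd, add_zero])
      hz' (by rw [sum_sub_single, hn]; push_cast; ring)
    exact ⟨z'', hz'', y + y', by rw [hy', hy, map_add, add_assoc]⟩

theorem exists_homologous_up (hd : ∀ x, bdry w (bdry w x) = 0) {a₀ b : V → ℤ} (hab : a₀ ≤ b)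
    (hstep : ∀ a ≤ a₀, a ≠ a₀ → ∃ v, a v < a₀ v ∧
      ∀ y, a ≤ y → y v = a v → w y ≤ w (y + Pi.single v 1))
    {a : V → ℤ} (ha : a ≤ a₀) {z : (V → ℤ) →₀ (ZMod 2)[X]} (hz : bdry w z = 0)
    (hzb : z ∈ Finsupp.supported (ZMod 2)[X] (ZMod 2)[X] (box a b)) :
    ∃ z' ∈ Finsupp.supported (ZMod 2)[X] (ZMod 2)[X] (box a₀ b), ∃ y, z' = z + bdry w y := by
  obtain ⟨n, hn⟩ : ∃ n : ℕ, ∑ u, (a₀ u - a u) = n :=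
    ⟨_, (Int.toNat_of_nonneg (Finset.sum_nonneg fun u _ => sub_nonneg.2 (ha u))).symm⟩
  induction n generalizing a z with
  | zero =>
    obtain rfl := eq_of_sum_eq_zero ha hn
    exact ⟨z, hzb, 0, by simp⟩
  | succ n ih =>
    obtain ⟨v, hv, hw⟩ := hstep a ha (by rintro rfl; simp at hn; omega)
    obtain ⟨z', hz', y, hy⟩ := (isPush_up (N := 0) (hv.trans_le (hab v))
      fun y hy h => by simpa using hw y hy.1 h).exists_homologous hzb hz
    rw [pow_zero, one_smul] at hy
    have ha' : a + Pi.single v 1 ≤ a₀ := le_sub_iff_add_le.1 (le_sub_single ha hv)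
    obtain ⟨z'', hz'', y', hy'⟩ := ih ha' (by rw [hy, map_add, hz, hd, add_zero])
      hz' (by
        have := sum_sub_single a₀ a v
        rw [hn] at this
        have e : ∑ u, (a₀ u - (a + Pi.single v 1 : V → ℤ) u) =
            ∑ u, ((a₀ - Pi.single v 1 : V → ℤ) u - a u) :=
          Finset.sum_congr rfl fun u _ => by simp only [Pi.add_apply, Pi.sub_apply]; ring
        rw [e, this]; push_cast; ring)
    exact ⟨z'', hz'', y + y', by rw [hy', hy, map_add, add_assoc]⟩

/-- Up to a power of `X`, every cycle is homologous to a multiple of a lattice point. -/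
theorem exists_pow_homologous_single (hd : ∀ x, bdry w (bdry w x) = 0) {a b : V → ℤ} (hab : a ≤ b)
    {z : (V → ℤ) →₀ (ZMod 2)[X]} (hz : bdry w z = 0)
    (hzb : z ∈ Finsupp.supported (ZMod 2)[X] (ZMod 2)[X] (box a b)) :
    ∃ (N : ℕ) (p : (ZMod 2)[X]) (y : (V → ℤ) →₀ (ZMod 2)[X]),
      Finsupp.single (fun u => 2 * a u) p = (X : (ZMod 2)[X]) ^ N • z + bdry w y := by
  obtain ⟨n, hn⟩ : ∃ n : ℕ, ∑ u, (b u - a u) = n :=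
    ⟨_, (Int.toNat_of_nonneg (Finset.sum_nonneg fun u _ => sub_nonneg.2 (hab u))).symm⟩
  induction n generalizing b z with
  | zero =>
    obtain rfl := eq_of_sum_eq_zero hab hn
    have hs : (box b b) = {fun u => 2 * b u} := by
      ext c
      simp only [box, Set.mem_ofPred_eq, Set.mem_singleton_iff, funext_iff]
      exact forall_congr' fun u => by omega
    rw [hs, Finsupp.mem_supported, Finset.coe_subset_singleton] at hzb
    obtain ⟨p, hp⟩ := Finsupp.support_subset_singleton'.1 hzb
    exact ⟨0, p, 0, by simp [hp]⟩
  | succ n ih =>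
    have hne : a ≠ b := by rintro rfl; simp at hn; omega
    obtain ⟨v, hv⟩ := (Pi.lt_def.1 (lt_of_le_of_ne hab hne)).2
    -- The box is finite, so the weight drop is bounded on it; multiplication by `X ^ N` pays for
    -- this drop.
    obtain ⟨N, hN⟩ : ∃ N : ℕ, ∀ y ∈ Finset.Icc a b, w y - w (y - Pi.single v 1) ≤ N := by
      obtain ⟨m, hm⟩ := ((Finset.Icc a b).image fun y => w y - w (y - Pi.single v 1)).bddAbove
      exact ⟨m.toNat, fun y hy =>
        (hm (Finset.mem_coe.2 (Finset.mem_image_of_mem _ hy))).trans (Int.self_le_toNat m)⟩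
    obtain ⟨z', hz', y, hy⟩ := (isPush_down (N := N) hv fun y hy _ => by
      have := hN y (Finset.mem_Icc.2 hy); omega).exists_homologous hzb hz
    obtain ⟨N', p, y', hy'⟩ := ih (le_sub_single hab hv)
      (by rw [hy, map_add, map_smul, hz, hd, smul_zero, add_zero])
      hz' (by rw [sum_sub_single, hn]; push_cast; ring)
    exact ⟨N' + N, p, (X : (ZMod 2)[X]) ^ N' • y + y', by
      rw [hy', hy, map_add, smul_add, smul_smul, map_smul, pow_add, add_assoc]⟩

/-! ### The augmentation -/

variable (w) in
/-- The augmentation, which is homogeneous of degree `-M`. -/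
def augmentation (M : ℤ) : ((V → ℤ) →₀ (ZMod 2)[X]) →ₗ[(ZMod 2)[X]] (ZMod 2)[X] :=
  Finsupp.linearCombination _ fun c =>
    if ∀ u, Even (c u) then (X : (ZMod 2)[X]) ^ (M - height w c).toNat else 0

theorem augmentation_single (M : ℤ) (c : V → ℤ) :
    augmentation w M (Finsupp.single c 1) =
      if ∀ u, Even (c u) then (X : (ZMod 2)[X]) ^ (M - height w c).toNat else 0 := by
  simp [augmentation]

theorem augmentation_single_two_mul (M : ℤ) (y : V → ℤ) (p : (ZMod 2)[X]) :
    augmentation w M (Finsupp.single (fun u => 2 * y u) p) = p * X ^ (M - w y).toNat := by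
  simp [augmentation, height_two_mul]

/-- Opposite faces of a cube contribute the same power of `X`, or both zero, and cancel in
characteristic 2. The bound `hM` prevents truncation of `M - height`. -/
theorem augmentation_bdry {M : ℤ} (hM : ∀ y, w y ≤ M) (x : (V → ℤ) →₀ (ZMod 2)[X]) :
    augmentation w M (bdry w x) = 0 := by
  suffices augmentation w M ∘ₗ bdry w = 0 from LinearMap.congr_fun this x
  refine Finsupp.lhom_ext' fun c => LinearMap.ext_ring ?_
  change augmentation w M (bdry w (Finsupp.single c 1)) = 0
  rw [bdry_single, bdryCube, map_sum]
  refine Finset.sum_eq_zero fun v hv => ?_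
  have hv' : Odd (c v) := by simpa using hv
  have hle : ∀ c, height w c ≤ M := fun c =>
    (height_le w (vertices_nonempty c).choose_spec).trans (hM _)
  have key : ∀ t : ℤ, t = 1 ∨ t = -1 → augmentation w M (move w 0 c (c + Pi.single v t)) =
      if ∀ u, u ≠ v → Even (c u) then (X : (ZMod 2)[X]) ^ (M - height w c).toNat else 0 := by
    intro t ht
    have hc := height_le_height_face w hv' ht
    have hodd : Odd t := by rcases ht with rfl | rfl <;> decide
    have hiff : (∀ u, Even ((c + Pi.single v t : V → ℤ) u)) ↔ ∀ u, u ≠ v → Even (c u) := by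
      refine ⟨fun h u hu => by simpa [hu] using h u, fun h u => ?_⟩
      by_cases e : u = v
      · subst e; simpa using hv'.add_odd hodd
      · simpa [e] using h u e
    rw [map_move, augmentation_single]
    simp only [hiff]
    split_ifs
    · rw [smul_eq_mul, ← pow_add]
      congr 1
      have := hle (c + Pi.single v t)
      omega
    · rw [smul_zero]
  rw [map_add, key 1 (Or.inl rfl), key (-1) (Or.inr rfl), char_two_add_self]

/-- After collapse to a point, the coefficient times a power of `X` is the augmentation, so it
vanishes. -/
theorem exists_pow_smul_eq_bdry (hd : ∀ x, bdry w (bdry w x) = 0) {M : ℤ} (hM : ∀ y, w y ≤ M)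
    {z : (V → ℤ) →₀ (ZMod 2)[X]} (hz : bdry w z = 0) (haug : augmentation w M z = 0) :
    ∃ (N : ℕ) (y : (V → ℤ) →₀ (ZMod 2)[X]), (X : (ZMod 2)[X]) ^ N • z = bdry w y := by
  obtain ⟨a, ha, b, hb, hzb⟩ := exists_mem_supported_box z 0 0
  obtain ⟨N, p, y, h⟩ := exists_pow_homologous_single hd (ha.trans hb) hz hzb
  have hp : p = 0 := by
    have := congrArg (augmentation w M) h
    rw [augmentation_single_two_mul, map_add, map_smul, haug, augmentation_bdry hM, smul_zero,
      add_zero] at this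
    exact (mul_eq_zero.1 this).resolve_right (pow_ne_zero _ X_ne_zero)
  refine ⟨N, -y, ?_⟩
  rw [hp, Finsupp.single_zero] at h
  rw [map_neg, eq_neg_iff_add_eq_zero, ← h]

end

end CubeComplex

/-! ### Negative definite forms and lattice weights -/

namespace PlumbingGraph

variable {V : Type*} [Fintype V] [DecidableEq V] {G : PlumbingGraph V}

theorem form_vert_vert (u v : V) : G.form (vert u) (vert v) = G.incidence u v := by
  simp [form, vert, Matrix.toBilin'_single]

theorem form_vert_vert_nonneg {u v : V} (h : u ≠ v) : 0 ≤ G.form (vert u) (vert v) := by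
  rw [form_vert_vert]
  simp only [incidence, Matrix.of_apply, if_neg h]
  split_ifs <;> simp

theorem form_apply_vert (x : V → ℤ) (v : V) :
    G.form x (vert v) = ∑ u, x u * G.form (vert u) (vert v) := by
  conv_lhs => rw [← Finset.univ_sum_single x]
  rw [map_sum, LinearMap.sum_apply]
  refine Finset.sum_congr rfl fun u _ => ?_
  rw [← smul_eq_mul (a := x u), ← LinearMap.smul_apply, ← map_smul]
  simp [vert, ← Pi.single_smul]

theorem form_apply (x y : V → ℤ) : G.form x y = ∑ v, y v * G.form x (vert v) := by
  conv_lhs => rw [← Finset.univ_sum_single y]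
  rw [map_sum]
  refine Finset.sum_congr rfl fun u _ => ?_
  rw [← smul_eq_mul (a := y u), ← map_smul]
  simp [vert, ← Pi.single_smul]

theorem dual_ext {f g : Module.Dual ℤ (V → ℤ)} (h : ∀ v, f (vert v) = g (vert v)) : f = g :=
  LinearMap.pi_ext' fun v => LinearMap.ext_ring (by simpa [vert] using h v)

theorem NegDef.form_injective (hG : G.NegDef) {x y : V → ℤ} (h : G.form x = G.form y) :
    x = y := by
  by_contra hne
  have := hG (x - y) (sub_ne_zero.2 hne)
  rw [map_sub G.form, h, sub_self, LinearMap.zero_apply] at this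
  exact lt_irrefl _ this

theorem NegDef.det_ne_zero (hG : G.NegDef) : G.incidence.det ≠ 0 := by
  intro h
  obtain ⟨x, hx, h0⟩ := Matrix.exists_mulVec_eq_zero_iff.2 h
  have := hG x hx
  simp [form, Matrix.toBilin'_apply', h0] at this

/-- Up to a nonzero factor, the form represents every functional. -/
theorem exists_form_eq_smul (K : Module.Dual ℤ (V → ℤ)) :
    ∃ x, G.form x = G.incidence.det • K := by
  -- The adjugate is the inverse with its denominator cleared.
  refine ⟨G.incidence.adjugate.mulVec fun v => K (vert v), dual_ext fun v => ?_⟩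
  rw [form_comm, form, vert, Matrix.toBilin'_apply', Matrix.mulVec_mulVec, Matrix.mul_adjugate,
    Matrix.smul_mulVec, Matrix.one_mulVec]
  simp [vert]

/-- There is a positive vector that is negative on all vertices. -/
theorem NegDef.exists_pos (hG : G.NegDef) :
    ∃ Z : V → ℤ, (∀ v, 0 < Z v) ∧ ∀ v, G.form Z (vert v) ≤ -1 := by
  obtain ⟨Y, hY⟩ := exists_form_eq_smul (G := G)
    (-∑ v, LinearMap.proj (R := ℤ) (φ := fun _ : V => ℤ) v)
  have hproj : ∀ v : V, (∑ u, LinearMap.proj (R := ℤ) (φ := fun _ : V => ℤ) u) (vert v) = 1 := by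
    intro v
    simp [LinearMap.sum_apply, vert, Pi.single_apply]
  set D := G.incidence.det
  have hD : D ≠ 0 := hG.det_ne_zero
  -- The second factor `D` makes the value `-D ^ 2`, negative whatever the sign of `D`.
  have hZ : ∀ v, G.form (D • Y) (vert v) ≤ -1 := by
    intro v
    rw [map_smul, hY, LinearMap.smul_apply, LinearMap.smul_apply, LinearMap.neg_apply, hproj]
    have : 0 < D ^ 2 := by positivity
    simp only [smul_eq_mul]
    nlinarith
  set Z := D • Y
  have hnn : ∀ v, 0 ≤ Z v := by
    -- the negative part of `Z`
    set N : V → ℤ := fun v => max (-Z v) 0 with hN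
    set P : V → ℤ := fun v => max (Z v) 0 with hP
    have hZP : Z = P - N := funext fun v => by simp only [hN, hP, Pi.sub_apply]; omega
    have h1 : G.form Z N ≤ 0 := by
      rw [form_apply]
      exact Finset.sum_nonpos fun v _ =>
        mul_nonpos_of_nonneg_of_nonpos (le_max_right _ _) ((hZ v).trans (by norm_num))
    have h2 : 0 ≤ G.form P N := by
      rw [form_apply]
      refine Finset.sum_nonneg fun v _ => ?_
      rw [form_apply_vert, Finset.mul_sum]
      refine Finset.sum_nonneg fun u _ => ?_
      by_cases huv : u = v
      · subst huv
        have : N u * P u = 0 := by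
          simp only [hN, hP]
          rcases le_total (Z u) 0 with h | h
          · rw [max_eq_right h, mul_zero]
          · rw [max_eq_right (neg_nonpos.2 h), zero_mul]
        rw [← mul_assoc, this, zero_mul]
      · exact mul_nonneg (le_max_right _ _)
          (mul_nonneg (le_max_right _ _) (form_vert_vert_nonneg huv))
    -- Otherwise N·N = P·N - Z·N ≥ 0 contradicts definiteness.
    have h3 : N = 0 := by
      by_contra hne
      have := hG N hne
      rw [hZP, map_sub, LinearMap.sub_apply] at h1
      linarith
    intro v
    have := congrFun h3 v
    simp only [hN, Pi.zero_apply] at this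
    omega
  refine ⟨Z, fun v => lt_of_le_of_ne (hnn v) fun h0 => ?_, hZ⟩
  have : 0 ≤ G.form Z (vert v) := by
    rw [form_apply_vert]
    refine Finset.sum_nonneg fun u _ => ?_
    by_cases huv : u = v
    · subst huv; rw [← h0, zero_mul]
    · exact mul_nonneg (hnn u) (form_vert_vert_nonneg huv)
  have := hZ v
  omega

/-- Outside of a large box, some face of the box has very negative product with its normal
direction. -/
theorem exists_form_vert_le {Z : V → ℤ} (hZ : ∀ v, 0 < Z v)
    (hZv : ∀ v, G.form Z (vert v) ≤ -1) {M : ℤ} (hM : 0 ≤ M) {b : V → ℤ} (hb : M • Z ≤ b)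
    (hne : b ≠ M • Z) :
    ∃ v, (M • Z) v < b v ∧ ∀ y ≤ b, y v = b v → G.form y (vert v) ≤ -M := by
  obtain ⟨u₀, hu₀⟩ := (Pi.lt_def.1 (lt_of_le_of_ne hb hne.symm)).2
  -- At a maximal ratio, `b` lies below the multiple of `Z` that touches it at `v`. Off-diagonal
  -- entries are nonnegative, so y·v is at most that multiple of Z·v.
  obtain ⟨v, -, hv⟩ := Finset.exists_max_image Finset.univ (fun v => (b v : ℚ) / Z v)
    ⟨u₀, Finset.mem_univ _⟩
  have hmax : ∀ u, b u * Z v ≤ b v * Z u := by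
    intro u
    have h := hv u (Finset.mem_univ u)
    rw [div_le_div_iff₀ (by exact_mod_cast hZ u) (by exact_mod_cast hZ v)] at h
    exact_mod_cast h
  simp only [Pi.smul_apply, smul_eq_mul] at hu₀ ⊢
  have hbv : M * Z v < b v := by
    have h1 := hmax u₀
    have h2 : M * Z u₀ * Z v < b u₀ * Z v := mul_lt_mul_of_pos_right hu₀ (hZ v)
    have h3 : M * Z v * Z u₀ < b v * Z u₀ := by linarith
    exact lt_of_mul_lt_mul_right h3 (hZ u₀).le
  refine ⟨v, hbv, fun y hy hyv => ?_⟩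
  have h1 : Z v * G.form y (vert v) ≤ b v * G.form Z (vert v) := by
    rw [form_apply_vert, form_apply_vert, Finset.mul_sum, Finset.mul_sum]
    refine Finset.sum_le_sum fun u _ => ?_
    rw [← mul_assoc, ← mul_assoc]
    by_cases huv : u = v
    · subst huv; rw [hyv, mul_comm (Z u)]
    · refine mul_le_mul_of_nonneg_right ?_ (form_vert_vert_nonneg huv)
      have := mul_le_mul_of_nonneg_left (hy u) (hZ v).le
      linarith [hmax u]
  have hb0 : 0 ≤ b v := (mul_nonneg hM (hZ v).le).trans hbv.le
  have h2 : b v * G.form Z (vert v) ≤ b v * (-1) := mul_le_mul_of_nonneg_left (hZv v) hb0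
  have h3 : Z v * G.form y (vert v) ≤ Z v * (-M) := by linarith
  exact le_of_mul_le_mul_left h3 (hZ v)

/-- The weight of a lattice point. -/
noncomputable def latticeWeight (K : G.Char) (x : V → ℤ) : ℤ := (K.1 x + G.form x x) / 2

theorem two_mul_latticeWeight (K : G.Char) (x : V → ℤ) :
    2 * latticeWeight K x = K.1 x + G.form x x := by
  refine Int.mul_ediv_cancel' ?_
  have h2 := Int.modEq_iff_dvd.1 (K.2 x)
  omega

theorem two_mul_latticeWeight_add (K : G.Char) (x y : V → ℤ) :
    2 * latticeWeight K (x + y) =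
      2 * latticeWeight K x + K.1 y + G.form y y + 2 * G.form x y := by
  rw [two_mul_latticeWeight, two_mul_latticeWeight]
  simp only [map_add, LinearMap.add_apply, form_comm y x]
  ring

/-- Complete the square: with z representing D·K, expand (2Dx + z)·(2Dx + z) ≤ 0. -/
theorem NegDef.latticeWeight_bddAbove (hG : G.NegDef) (K : G.Char) :
    ∃ M, ∀ x, latticeWeight K x ≤ M := by
  obtain ⟨z, hz⟩ := exists_form_eq_smul (G := G) K.1
  set D := G.incidence.det
  have hD : D ≠ 0 := hG.det_ne_zero
  have hnp : ∀ x, G.form x x ≤ 0 := fun x => by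
    by_cases hx : x = 0
    · simp [hx]
    · exact (hG x hx).le
  refine ⟨-G.form z z, fun x => ?_⟩
  have h1 := hnp ((2 * D) • x + z)
  simp only [map_add, map_smul, LinearMap.add_apply, LinearMap.smul_apply, form_comm x z,
    smul_eq_mul] at h1
  rw [hz] at h1
  simp only [LinearMap.smul_apply, smul_eq_mul] at h1
  have h2 := two_mul_latticeWeight K x
  have h3 : 0 < D ^ 2 := by positivity
  have h4 := hnp z
  rw [hz, LinearMap.smul_apply, smul_eq_mul] at h4 ⊢
  have h5 : 8 * D ^ 2 * latticeWeight K x ≤ -(D * K.1 z) := by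
    have : 8 * D ^ 2 * latticeWeight K x = 4 * D ^ 2 * (K.1 x + G.form x x) := by rw [← h2]; ring
    rw [this]; linarith
  by_contra! hlt
  nlinarith

theorem NegDef.exists_max_latticeWeight (hG : G.NegDef) (K : G.Char) :
    ∃ x, ∀ y, latticeWeight K y ≤ latticeWeight K x := by
  obtain ⟨M, hM⟩ := hG.latticeWeight_bddAbove K
  obtain ⟨m, ⟨x, rfl⟩, hm⟩ := Int.exists_greatest_of_bdd (P := fun m => ∃ x, latticeWeight K x = m)
    ⟨M, by rintro _ ⟨x, rfl⟩; exact hM x⟩ ⟨_, 0, rfl⟩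
  exact ⟨x, fun y => hm _ ⟨y, rfl⟩⟩

/-- Outside of a large box, moving towards the box does not decrease the weight. -/
theorem NegDef.exists_box (hG : G.NegDef) (K : G.Char) :
    ∃ a₀ b₀ : V → ℤ, a₀ ≤ b₀ ∧
      (∀ b, b₀ ≤ b → b ≠ b₀ → ∃ v, b₀ v < b v ∧
        ∀ y ≤ b, y v = b v → latticeWeight K y ≤ latticeWeight K (y - Pi.single v 1)) ∧
      ∀ a ≤ a₀, a ≠ a₀ → ∃ v, a v < a₀ v ∧
        ∀ y, a ≤ y → y v = a v → latticeWeight K y ≤ latticeWeight K (y + Pi.single v 1) := by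
  obtain ⟨Z, hZ, hZv⟩ := hG.exists_pos
  -- Large enough that y·v ≤ -M outweighs the terms K(v) and v·v in the weight change.
  set M : ℤ := ∑ v, (|K.1 (vert v)| + |G.form (vert v) (vert v)|)
  have hM : 0 ≤ M := Finset.sum_nonneg fun v _ => by positivity
  have hMv : ∀ v, |K.1 (vert v)| + |G.form (vert v) (vert v)| ≤ M := fun v =>
    Finset.single_le_sum (f := fun v => |K.1 (vert v)| + |G.form (vert v) (vert v)|)
      (fun v _ => by positivity) (Finset.mem_univ v)
  have hMZ : 0 ≤ M • Z := fun v => mul_nonneg hM (hZ v).le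
  refine ⟨-(M • Z), M • Z, (neg_nonpos.2 hMZ).trans hMZ, fun b hb hne => ?_, fun a ha hne => ?_⟩
  · obtain ⟨v, hv, h⟩ := exists_form_vert_le hZ hZv hM hb hne
    refine ⟨v, hv, fun y hy hyv => ?_⟩
    have h1 := h y hy hyv
    have h2 := two_mul_latticeWeight_add K y (-vert v)
    simp only [← sub_eq_add_neg, map_neg, LinearMap.neg_apply, neg_neg] at h2
    have h3 := hMv v
    have h4 := le_abs_self (K.1 (vert v))
    have h5 := neg_abs_le (G.form (vert v) (vert v))
    change _ ≤ latticeWeight K (y - vert v)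
    linarith
  -- Lower corners reduce to upper ones by x ↦ -x.
  · obtain ⟨v, hv, h⟩ := exists_form_vert_le hZ hZv hM (b := -a) (le_neg.2 ha)
      (fun e => hne (by rw [← e, neg_neg]))
    refine ⟨v, by simp only [Pi.neg_apply] at hv ⊢; omega, fun y hy hyv => ?_⟩
    have h1 := h (-y) (neg_le_neg hy) (by simp [hyv])
    have h2 := two_mul_latticeWeight_add K y (vert v)
    rw [map_neg, LinearMap.neg_apply] at h1
    have h3 := hMv v
    have h4 := neg_abs_le (K.1 (vert v))
    have h5 := neg_abs_le (G.form (vert v) (vert v))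
    change _ ≤ latticeWeight K (y + vert v)
    linarith

end PlumbingGraph

/-! ### The lattice complex as a complex of cubes -/

namespace PlumbingGraph

noncomputable section

variable {V : Type*} [Fintype V] [DecidableEq V] {G : PlumbingGraph V} {s : G.SpinC}

/-- The characteristic element `K + 2 x^*`, where `x^* = (x · -)`. -/
def CharIn.translate (K : G.CharIn s) (x : V → ℤ) : G.CharIn s :=
  ⟨⟨K.1.1 + (2 : ℤ) • G.form x, fun y => by
    refine (Int.modEq_iff_dvd.2 ⟨-(G.form x y), ?_⟩ : _ ≡ K.1.1 y [ZMOD 2]).trans (K.1.2 y)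
    simp only [LinearMap.add_apply, LinearMap.smul_apply, smul_eq_mul]
    ring⟩,
  (Quotient.sound (s := G.spincSetoid) ⟨x, by simp⟩ : _ = K.1.spinc).trans K.2⟩

theorem CharIn.shift_translate (K : G.CharIn s) (x : V → ℤ) (v : V) :
    (K.translate x).shift v = K.translate (x + vert v) := by
  refine Subtype.ext (Subtype.ext ?_)
  simp only [CharIn.shift, CharIn.translate, Char.shift, map_add, smul_add, add_assoc]

/-- Injectivity is nondegeneracy of the form; surjectivity is the definition of the spin^c
equivalence. -/
theorem CharIn.translate_bijective (hG : G.NegDef) (K : G.CharIn s) :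
    Function.Bijective K.translate := by
  refine ⟨fun x y h => hG.form_injective ?_, fun K' => ?_⟩
  · have h' : K.1.1 + (2 : ℤ) • G.form x = K.1.1 + (2 : ℤ) • G.form y :=
      congrArg (fun L : G.CharIn s => L.1.1) h
    exact smul_right_injective _ (two_ne_zero (α := ℤ)) (add_left_cancel h')
  · obtain ⟨x, hx⟩ := Quotient.exact (s := G.spincSetoid) (K'.2.trans K.2.symm)
    exact ⟨x, Subtype.ext (Subtype.ext (by simp only [CharIn.translate, ← hx]; abel))⟩

/-- Twice the centre of the cube with lowest vertex `x` and directions `E`. -/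
def cubeCenter (x : V → ℤ) (E : Finset V) : V → ℤ := fun u => 2 * x u + if u ∈ E then 1 else 0

theorem odd_cubeCenter {x : V → ℤ} {E : Finset V} {u : V} : Odd (cubeCenter x E u) ↔ u ∈ E := by
  unfold cubeCenter
  split_ifs with h <;> simp [h, parity_simps]

/-- A cube is determined by its centre. -/
def cubeEquiv : (V → ℤ) × Finset V ≃ (V → ℤ) where
  toFun p := cubeCenter p.1 p.2
  invFun c := (fun u => c u / 2, Finset.univ.filter fun u => Odd (c u))
  left_inv p := by
    refine Prod.ext (funext fun u => ?_) (Finset.ext fun u => by simp [odd_cubeCenter])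
    simp only [cubeCenter]
    split_ifs <;> omega
  right_inv c := funext fun u => by
    simp only [cubeCenter, Finset.mem_filter, Finset.mem_univ, true_and]
    split_ifs with h
    · obtain ⟨k, hk⟩ := h; omega
    · obtain ⟨k, hk⟩ := Int.not_odd_iff_even.1 h; omega

theorem cubeCenter_erase (x : V → ℤ) {E : Finset V} {v : V} (hv : v ∈ E) :
    cubeCenter x (E.erase v) = cubeCenter x E + Pi.single v (-1) := by
  funext u
  by_cases h : u = v
  · subst h; simp [cubeCenter, hv]
  · simp [cubeCenter, h]

theorem cubeCenter_add_vert_erase (x : V → ℤ) {E : Finset V} {v : V} (hv : v ∈ E) :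
    cubeCenter (x + vert v) (E.erase v) = cubeCenter x E + Pi.single v 1 := by
  funext u
  by_cases h : u = v
  · subst h; simp [cubeCenter, hv, vert]; ring
  · simp [cubeCenter, h, vert]

theorem latticeWeight_add_sum_vert (K : G.CharIn s) (x : V → ℤ) (I : Finset V) :
    latticeWeight K.1 (x + ∑ v ∈ I, vert v) =
      latticeWeight K.1 x + weight (K.translate x).1 I := by
  have h1 := two_mul_latticeWeight_add K.1 x (∑ v ∈ I, vert v)
  have h2 := two_mul_weight (K.translate x).1 I
  rw [← map_sum] at h2
  simp only [CharIn.translate, LinearMap.add_apply, LinearMap.smul_apply, smul_eq_mul] at h2 ⊢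
  linarith

theorem sum_vert_apply (I : Finset V) (u : V) :
    (∑ v ∈ I, vert v : V → ℤ) u = if u ∈ I then 1 else 0 := by
  simp [vert, Finset.sum_apply, Pi.single_apply]

/-- The vertices of the cube are the x + ∑_{v ∈ I} v with I ⊆ E, and their weights relative to x are
the f([K + 2x^*, I]). -/
theorem height_cubeCenter (K : G.CharIn s) (x : V → ℤ) (E : Finset V) :
    CubeComplex.height (latticeWeight K.1) (cubeCenter x E) =
      latticeWeight K.1 x + minWeight (K.translate x).1 E := by
  refine le_antisymm ?_ (CubeComplex.le_height.2 fun y hy => ?_)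
  · rw [← sub_le_iff_le_add']
    refine Finset.le_inf' _ _ fun I hI => ?_
    rw [sub_le_iff_le_add', ← latticeWeight_add_sum_vert]
    refine CubeComplex.height_le _ (CubeComplex.mem_vertices.2 fun u => ?_)
    simp only [Pi.add_apply, sum_vert_apply, cubeCenter]
    have : u ∈ I → u ∈ E := fun h => Finset.mem_powerset.1 hI h
    split_ifs <;> first | omega | exact absurd (this ‹_›) ‹_›
  · rw [CubeComplex.mem_vertices] at hy
    have hyx : y = x + ∑ v ∈ E.filter (fun v => y v ≠ x v), vert v := by
      funext u
      have := hy u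
      simp only [Pi.add_apply, sum_vert_apply, Finset.mem_filter, cubeCenter] at this ⊢
      split_ifs at this ⊢ with h1 h2 <;> simp_all <;> omega
    rw [hyx, latticeWeight_add_sum_vert, add_le_add_iff_left]
    exact Finset.inf'_le _ (Finset.mem_powerset.2 (Finset.filter_subset _ _))

/-- The generators `[K, E]` correspond to the cubes of the lattice. -/
def genEquiv (hG : G.NegDef) (K : G.CharIn s) : G.CharIn s × Finset V ≃ (V → ℤ) :=
  ((Equiv.ofBijective _ (K.translate_bijective hG)).symm.prodCongr (Equiv.refl _)).trans cubeEquiv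

theorem genEquiv_translate (hG : G.NegDef) (K : G.CharIn s) (x : V → ℤ) (E : Finset V) :
    genEquiv hG K (K.translate x, E) = cubeCenter x E := by
  have : (Equiv.ofBijective _ (K.translate_bijective hG)).symm (K.translate x) = x :=
    Equiv.ofBijective_symm_apply_apply _ _ x
  simp only [genEquiv, Equiv.trans_apply, Equiv.prodCongr_apply, Prod.map_apply, this]
  rfl

/-- The lattice chain complex as a complex of cubes. -/
def cubeIso (hG : G.NegDef) (K : G.CharIn s) :
    G.CF s ≃ₗ[(ZMod 2)[X]] ((V → ℤ) →₀ (ZMod 2)[X]) :=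
  Finsupp.domLCongr (genEquiv hG K)

theorem cubeIso_gen (hG : G.NegDef) (K : G.CharIn s) (x : V → ℤ) (E : Finset V) :
    cubeIso hG K (gen (K.translate x) E) = Finsupp.single (cubeCenter x E) 1 := by
  rw [cubeIso, gen, Finsupp.domLCongr_single, genEquiv_translate]

theorem cubeIso_bdry (hG : G.NegDef) (K : G.CharIn s) (z : G.CF s) :
    cubeIso hG K (G.bdry s z) = CubeComplex.bdry (latticeWeight K.1) (cubeIso hG K z) := by
  suffices (cubeIso hG K).toLinearMap ∘ₗ G.bdry s =
      CubeComplex.bdry (latticeWeight K.1) ∘ₗ (cubeIso hG K).toLinearMap from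
    LinearMap.congr_fun this z
  refine Finsupp.lhom_ext' fun p => LinearMap.ext_ring ?_
  obtain ⟨K', E⟩ := p
  obtain ⟨x, rfl⟩ := (K.translate_bijective hG).2 K'
  change cubeIso hG K (G.bdry s (gen (K.translate x) E)) =
    CubeComplex.bdry (latticeWeight K.1) (cubeIso hG K (gen (K.translate x) E))
  rw [bdry_gen, cubeIso_gen, CubeComplex.bdry_single, CubeComplex.bdryCube, bdryGen, map_sum]
  have hE : Finset.univ.filter (fun u => Odd (cubeCenter x E u)) = E := by
    ext u; simp [odd_cubeCenter]
  rw [hE]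
  refine Finset.sum_congr rfl fun v hv => ?_
  have ha := coe_aExp (K.translate x).1 E v
  have hb := coe_bExp (K.translate x).1 hv
  have hs : (K.translate x).1.shift v = (K.translate (x + vert v)).1 :=
    congrArg Subtype.val (K.shift_translate x v)
  have hw := latticeWeight_add_sum_vert K x {v}
  rw [Finset.sum_singleton] at hw
  rw [hs] at hb
  -- The term with K + 2v^* is the upper face, which `bdryCube` lists first.
  rw [add_comm, map_add, map_smul, map_smul, K.shift_translate, cubeIso_gen, cubeIso_gen,
    cubeCenter_add_vert_erase x hv, cubeCenter_erase x hv, CubeComplex.move, CubeComplex.move,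
    Finsupp.smul_single, Finsupp.smul_single, smul_eq_mul, smul_eq_mul, mul_one, mul_one,
    ← cubeCenter_erase x hv, ← cubeCenter_add_vert_erase x hv, height_cubeCenter,
    height_cubeCenter, height_cubeCenter]
  congr 3 <;> omega

/-- Transported from `bdry_bdry` along the isomorphism. -/
theorem cube_bdry_bdry (hG : G.NegDef) (K : G.CharIn s) (z : (V → ℤ) →₀ (ZMod 2)[X]) :
    CubeComplex.bdry (latticeWeight K.1) (CubeComplex.bdry (latticeWeight K.1) z) = 0 := by
  obtain ⟨z, rfl⟩ := (cubeIso hG K).surjective z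
  rw [← cubeIso_bdry, ← cubeIso_bdry, ← LinearMap.comp_apply, bdry_bdry, LinearMap.zero_apply,
    map_zero]

/-- Every cycle is homologous to a chain in a fixed finite set of cubes. -/
theorem exists_finite_homologous (hG : G.NegDef) (s : G.SpinC) :
    ∃ S : Set (G.CharIn s × Finset V), S.Finite ∧ ∀ z, G.bdry s z = 0 →
      ∃ z' ∈ Finsupp.supported (ZMod 2)[X] (ZMod 2)[X] S, ∃ y, z' = z + G.bdry s y := by
  obtain ⟨K, hK⟩ := Quotient.exists_rep s
  let K₀ : G.CharIn s := ⟨K, hK⟩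
  obtain ⟨a₀, b₀, hab, hdown, hup⟩ := hG.exists_box K₀.1
  refine ⟨genEquiv hG K₀ ⁻¹' CubeComplex.box a₀ b₀,
    (CubeComplex.box_finite a₀ b₀).preimage (genEquiv hG K₀).injective.injOn, fun z hz => ?_⟩
  have hd := cube_bdry_bdry hG K₀
  have hz' : CubeComplex.bdry (latticeWeight K₀.1) (cubeIso hG K₀ z) = 0 := by
    rw [← cubeIso_bdry, hz, map_zero]
  obtain ⟨a, ha, b, hb, hzb⟩ := CubeComplex.exists_mem_supported_box (cubeIso hG K₀ z) a₀ b₀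
  obtain ⟨z₁, hz₁, y₁, h₁⟩ :=
    CubeComplex.exists_homologous_down hd (ha.trans hab) hdown hb hz' hzb
  obtain ⟨z₂, hz₂, y₂, h₂⟩ := CubeComplex.exists_homologous_up hd hab hup ha
    (by rw [h₁, map_add, hz', hd, add_zero]) hz₁
  refine ⟨(cubeIso hG K₀).symm z₂, fun p hp => ?_, (cubeIso hG K₀).symm (y₁ + y₂), ?_⟩
  · refine hz₂ ?_
    rw [Finset.mem_coe, Finsupp.mem_support_iff] at hp
    exact Finset.mem_coe.2 (Finsupp.mem_support_iff.2 hp)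
  · apply (cubeIso hG K₀).injective
    rw [map_add, cubeIso_bdry, LinearEquiv.apply_symm_apply, LinearEquiv.apply_symm_apply, h₂, h₁,
      map_add, add_assoc]

/-- The augmentation of the lattice chain complex. -/
theorem exists_augmentation (hG : G.NegDef) (s : G.SpinC) :
    ∃ (ε : G.CF s →ₗ[(ZMod 2)[X]] (ZMod 2)[X]) (K : G.CharIn s),
      (∀ x, ε (G.bdry s x) = 0) ∧ ε (gen K ∅) = 1 ∧
      ∀ z, G.bdry s z = 0 → ε z = 0 →
        ∃ (N : ℕ) (y : G.CF s), (X : (ZMod 2)[X]) ^ N • z = G.bdry s y := by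
  obtain ⟨K, hK⟩ := Quotient.exists_rep s
  let K₀ : G.CharIn s := ⟨K, hK⟩
  obtain ⟨x, hx⟩ := hG.exists_max_latticeWeight K₀.1
  refine ⟨CubeComplex.augmentation (latticeWeight K₀.1) (latticeWeight K₀.1 x) ∘ₗ
    (cubeIso hG K₀).toLinearMap, K₀.translate x, fun y => ?_, ?_, fun z hz hε => ?_⟩
  · simp only [LinearMap.comp_apply, LinearEquiv.coe_coe, cubeIso_bdry]
    exact CubeComplex.augmentation_bdry hx _
  · have hc : cubeCenter x ∅ = fun u => 2 * x u := funext fun u => by simp [cubeCenter]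
    simp only [LinearMap.comp_apply, LinearEquiv.coe_coe, cubeIso_gen, hc,
      CubeComplex.augmentation_single_two_mul]
    simp
  · obtain ⟨N, y, hy⟩ := CubeComplex.exists_pow_smul_eq_bdry (cube_bdry_bdry hG K₀) hx
      (z := cubeIso hG K₀ z) (by rw [← cubeIso_bdry, hz, map_zero]) hε
    refine ⟨N, (cubeIso hG K₀).symm y, (cubeIso hG K₀).injective ?_⟩
    rw [map_smul, cubeIso_bdry, LinearEquiv.apply_symm_apply, hy]

end

end PlumbingGraph

/-! ### Homology modules and their decomposition -/

namespace SqZero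

section

variable {R M : Type*} [Ring R] [AddCommGroup M] [Module R M] (d : M →ₗ[R] M) (h : d ∘ₗ d = 0)

/-- The class of a cycle. -/
def homologyClass : LinearMap.ker d →ₗ[R] Homology d h := Submodule.mkQ _

theorem homologyClass_surjective : Function.Surjective (homologyClass d h) :=
  Submodule.mkQ_surjective _

theorem homologyClass_eq_zero {z : LinearMap.ker d} :
    homologyClass d h z = 0 ↔ ∃ y, d y = z := by
  refine (Submodule.Quotient.mk_eq_zero _).trans ⟨?_, ?_⟩
  · rintro ⟨y, rfl⟩
    exact ⟨y, rfl⟩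
  · rintro ⟨y, hy⟩
    exact ⟨y, Subtype.ext hy⟩

theorem homologyClass_mem_classesOf {S : Submodule R M} {z : LinearMap.ker d} (hz : (z : M) ∈ S) :
    homologyClass d h z ∈ classesOf d h S :=
  ⟨z, hz, rfl⟩

/-- A linear map that vanishes on boundaries descends to the homology. -/
theorem exists_homology_lift {N : Type*} [AddCommGroup N] [Module R N] (f : M →ₗ[R] N)
    (hf : ∀ y, f (d y) = 0) :
    ∃ F : Homology d h →ₗ[R] N, ∀ z, F (homologyClass d h z) = f z :=
  ⟨Submodule.liftQ _ (f ∘ₗ (LinearMap.ker d).subtype) (by rintro _ ⟨y, rfl⟩; exact hf y),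
    fun _ => rfl⟩

end

/-- The homology of a complex of free modules over a Noetherian ring is finitely generated if
every cycle is homologous to one in the span of a fixed finite set of generators. -/
theorem finite_homology {R ι : Type*} [Ring R] [IsNoetherianRing R]
    {d : (ι →₀ R) →ₗ[R] (ι →₀ R)} (h : d ∘ₗ d = 0) {S : Set ι} (hS : S.Finite)
    (hd : ∀ z, d z = 0 → ∃ z' ∈ Finsupp.supported R R S, ∃ y, z' = z + d y) :
    Module.Finite R (Homology d h) := by
  have := hS.to_subtype
  have hN : IsNoetherian R (Finsupp.supported R R S) :=
    isNoetherian_of_linearEquiv (Finsupp.supportedEquivFinsupp (M := R) (R := R) S).symm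
  have hT : ((Finsupp.supported R R S).comap (LinearMap.ker d).subtype).FG :=
    Submodule.fg_of_fg_map_injective _ (Submodule.injective_subtype _)
      (isNoetherian_submodule.1 hN _ (Submodule.map_comap_le _ _))
  have hB : ((Finsupp.supported R R S).comap (LinearMap.ker d).subtype).map
      (homologyClass d h) = ⊤ := by
    refine eq_top_iff.2 fun q _ => ?_
    obtain ⟨⟨z, hz⟩, rfl⟩ := homologyClass_surjective d h q
    obtain ⟨z', hz', y, hy⟩ := hd z hz
    have hdz' : d z' = 0 := by
      rw [hy, map_add, LinearMap.mem_ker.1 hz, zero_add]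
      exact LinearMap.congr_fun h y
    refine ⟨⟨z', hdz'⟩, hz', ?_⟩
    rw [← sub_eq_zero, ← map_sub, homologyClass_eq_zero]
    exact ⟨y, by simp [hy]⟩
  exact ⟨hB ▸ hT.map (homologyClass d h)⟩

end SqZero

/-- The direct sum decomposition of a finitely generated `p ^ ∞`-torsion module, with positive
exponents. -/
theorem exists_equiv_directSum_pos {R M : Type*} [CommRing R] [IsDomain R]
    [IsPrincipalIdealRing R] [AddCommGroup M] [Module R M] [Module.Finite R M] {p : R}
    (hp : Irreducible p) (hM : Module.IsTorsion' M (Submonoid.powers p)) :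
    ∃ (r : ℕ) (n : Fin r → ℕ), (∀ i, 0 < n i) ∧
      Nonempty (M ≃ₗ[R] ⨁ i : Fin r, R ⧸ Ideal.span {p ^ n i}) := by
  classical
  obtain ⟨d, k, ⟨e⟩⟩ := Module.torsion_by_prime_power_decomposition hp hM
  let σ : Fin (Fintype.card {i // 0 < k i}) ≃ {i // 0 < k i} := (Fintype.equivFin _).symm
  refine ⟨_, fun i => k (σ i), fun i => (σ i).2, ?_⟩
  -- Summands with exponent zero are trivial and can be dropped.
  have h0 : ∀ i, ¬ 0 < k i → Subsingleton (R ⧸ R ∙ p ^ k i) := fun i hi => by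
    rw [Nat.eq_zero_of_not_pos hi, pow_zero]
    exact Submodule.Quotient.subsingleton_iff.2 Ideal.span_singleton_one
  let f : (Π i : Fin d, R ⧸ R ∙ p ^ k i) →ₗ[R] Π i, R ⧸ R ∙ p ^ k (σ i) :=
    { toFun := fun x i => x (σ i)
      map_add' := fun _ _ => rfl
      map_smul' := fun _ _ => rfl }
  have hf : Function.Bijective f := by
    refine ⟨fun x y hxy => funext fun i => ?_, fun y => ?_⟩
    · by_cases hi : 0 < k i
      · obtain ⟨j, hj⟩ := σ.surjective ⟨i, hi⟩
        have := congrFun hxy j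
        change x (σ j) = y (σ j) at this
        rwa [hj] at this
      · have := h0 i hi
        exact Subsingleton.elim _ _
    -- Quantifying over `j` and `hj` lets the dependent cast disappear at `rfl`.
    · have key : ∀ i : {i // 0 < k i}, ∃ t : R ⧸ R ∙ p ^ k i, ∀ j, (hj : σ j = i) →
          y j = hj ▸ t := by
        intro i
        obtain ⟨j, rfl⟩ := σ.surjective i
        refine ⟨y j, fun j' hj' => ?_⟩
        obtain rfl := σ.injective hj'
        rfl
      choose t ht using key
      refine ⟨fun i => if hi : 0 < k i then t ⟨i, hi⟩ else 0, funext fun j => ?_⟩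
      change (if hi : 0 < k (σ j) then t ⟨σ j, hi⟩ else 0) = y j
      rw [dif_pos (σ j).2]
      exact (ht (σ j) j rfl).symm
  exact ⟨e.trans (((DirectSum.linearEquivFunOnFintype R (Fin d) fun i => R ⧸ R ∙ p ^ k i).trans
    (LinearEquiv.ofBijective f hf)).trans
      (DirectSum.linearEquivFunOnFintype R _ fun i => R ⧸ R ∙ p ^ k (σ i)).symm)⟩

/-- A functional that takes the value `1` splits off a free summand. -/
theorem exists_equiv_prod_ker {R M : Type*} [CommRing R] [AddCommGroup M] [Module R M]
    (f : M →ₗ[R] R) {g : M} (hg : f g = 1) :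
    ∃ e : M ≃ₗ[R] R × LinearMap.ker f, ∀ p, e.symm (p, 0) = p • g := by
  have hker : ∀ x, (LinearMap.id - f.smulRight g : M →ₗ[R] M) x ∈ LinearMap.ker f := fun x => by
    simp [hg]
  have h1 : ∀ (p : R) (t : LinearMap.ker f), f (p • g + t) = p := fun p t => by
    rw [map_add, map_smul, hg, LinearMap.mem_ker.1 t.2, smul_eq_mul, mul_one, add_zero]
  refine ⟨LinearEquiv.ofLinearMap
    (f.prod ((LinearMap.id - f.smulRight g).codRestrict (LinearMap.ker f) hker))
    ((LinearMap.toSpanSingleton R M g).coprod (LinearMap.ker f).subtype)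
    (LinearMap.ext fun p => ?_) (LinearMap.ext fun x => ?_), fun p => ?_⟩
  · refine Prod.ext (h1 p.1 p.2) (Subtype.ext ?_)
    change p.1 • g + (p.2 : M) - f (p.1 • g + p.2) • g = p.2
    rw [h1, add_sub_cancel_left]
  · change f x • g + (x - f x • g) = x
    abel
  · simp

/-! ### The structure theorem -/

theorem mainTheorem9 {V : Type*} [Fintype V] [DecidableEq V] (G : PlumbingGraph V)
    (htree : G.graph.IsTree) (hneg : G.NegDef) (s : G.SpinC) :
    Module.Finite (ZMod 2)[X] (G.HF s) ∧
      ∃ (r : ℕ) (n : Fin r → ℕ)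
        (e : G.HF s ≃ₗ[(ZMod 2)[X]]
          ((ZMod 2)[X] × ⨁ i : Fin r, (ZMod 2)[X] ⧸ Ideal.span {(X : (ZMod 2)[X]) ^ n i})),
        (∀ i, 0 < n i) ∧ ∀ p : (ZMod 2)[X], e.symm (p, 0) ∈ G.HFdeg s 0 := by
  obtain ⟨S, hS, hSd⟩ := PlumbingGraph.exists_finite_homologous hneg s
  have hfin : Module.Finite (ZMod 2)[X] (G.HF s) :=
    SqZero.finite_homology (G.bdry_bdry s) hS hSd
  refine ⟨hfin, ?_⟩
  obtain ⟨ε, K, hεd, hε1, hεt⟩ := PlumbingGraph.exists_augmentation hneg s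
  obtain ⟨εH, hεH⟩ := SqZero.exists_homology_lift (G.bdry s) (G.bdry_bdry s) ε hεd
  have hK : PlumbingGraph.gen K ∅ ∈ LinearMap.ker (G.bdry s) := by
    rw [LinearMap.mem_ker, G.bdry_gen, PlumbingGraph.bdryGen, Finset.sum_empty]
  -- This class generates the free summand, in δ-degree 0 because its cube is a point.
  have hg : εH (SqZero.homologyClass (G.bdry s) (G.bdry_bdry s) ⟨_, hK⟩) = 1 := by
    rw [hεH, hε1]
  have htors : Module.IsTorsion' (LinearMap.ker εH)
      (Submonoid.powers (X : (ZMod 2)[X])) := by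
    rintro ⟨q, hq⟩
    obtain ⟨⟨z, hz⟩, rfl⟩ := SqZero.homologyClass_surjective _ _ q
    rw [LinearMap.mem_ker, hεH] at hq
    obtain ⟨N, y, hy⟩ := hεt z hz hq
    refine ⟨⟨X ^ N, N, rfl⟩, Subtype.ext ?_⟩
    change (X : (ZMod 2)[X]) ^ N • SqZero.homologyClass _ _ ⟨z, hz⟩ = 0
    rw [← map_smul, SqZero.homologyClass_eq_zero]
    exact ⟨y, hy.symm⟩
  obtain ⟨r, n, hn, ⟨e⟩⟩ := exists_equiv_directSum_pos (irreducible_X (R := ZMod 2)) htors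
  obtain ⟨split, hsplit⟩ := exists_equiv_prod_ker εH hg
  refine ⟨r, n, split.trans ((LinearEquiv.refl _ _).prodCongr e), hn, fun p => ?_⟩
  have hp : (split.trans ((LinearEquiv.refl _ _).prodCongr e)).symm (p, 0) =
      p • SqZero.homologyClass (G.bdry s) (G.bdry_bdry s) ⟨_, hK⟩ := by
    rw [← hsplit p]
    simp
  rw [hp]
  exact Submodule.smul_mem _ _ (SqZero.homologyClass_mem_classesOf _ _
    (Finsupp.single_mem_supported _ _ Finset.card_empty))
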